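/- Let $n\ge 0$, let $R$ be a commutative ring, and let $x_{ij}=x_{ji}$ ($1\le i,j\le n$) be symmetric indeterminates (one independent indeterminate for each unordered pair $\{i,j\}$). All operators below act $R$-linearly on the polynomial ring $R[x_{ij}]$: $x_{ij}$ acts by multiplication and $\partial/\partial x_{ij}$ as the formal partial derivative. For a matrix $A=(A_{ij})$ of operators let $$\det(A)=\sum_{\sigma\in\mathcal S_n}(-1)^\sigma A_{\sigma(1)1}A_{\sigma(2)2}\cdots A_{\sigma(n)n},$$ and put $$S_{ij}=\sum_{k=1}^n(1+\delta_{jk})\,x_{ik}\frac{\partial}{\partial x_{jk}} .$$ (a) (Turnbull's identity) As operators, $$\det\bigl(S_{ij}+\delta_{ij}(n-i)\bigr)=\det(x_{ij})\cdot\det\Bigl((1+\delta_{ij})\frac{\partial}{\partial x_{ij}}\Bigr).$$ (b) Let $y_{ij}=y_{ji}$ be further symmetric indeterminates commuting with the $x_{ij}$, and let $F\mapsto F(\partial)$ be the $R$-linear map from polynomials in $x,y$ to operators with $(G(x)H(y))(\partial)=G(x)\,H(\partial/\partial x)$. Put $\Sigma_{ij}=\sum_{k}(1+\delta_{jk})x_{ik}y_{jk}$.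 A Capelli configuration $(\sigma,\varphi)$ is a permutation $\sigma\in\mathcal S_n$ together with a number $\varphi(i)\in\{1,\dots,i\}$ for each $i$ with $\sigma(i)=i$. Let $\mathcal C^m$ be the set of those for which $\sigma(k)=k$ and $\varphi(k)<k$ imply $k\ge m$. Let $\tilde\Sigma_{\sigma(i)i}=\Sigma_{\sigma(i)i}$ if $\sigma(i)\ne i$ or $\varphi(i)=i$, and $\tilde\Sigma_{\sigma(i)i}=1$ otherwise, and $$\Sigma(\sigma,\varphi,m)=\Bigl(\prod_{i=n,n-1,\dots;\ i\ge \max(m,1)}\tilde\Sigma_{\sigma(i)i}(\partial)\Bigr)\cdot\Bigl(\prod_{1\le i<m}\tilde\Sigma_{\sigma(i)i}\Bigr)(\partial),$$ where the operators in the first product are composed from left to right in decreasing order of $i$. Then for every $0\le m\le n$, $$\sum_{(\sigma,\varphi)\in\mathcal C^{m+1}}(-1)^\sigma\,\Sigma(\sigma,\varphi,m+1)=\sum_{(\sigma,\varphi)\in\mathcal C^{m}}(-1)^\sigma\,\Sigma(\sigma,\varphi,m).$$ -/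

import Mathlib

open Equiv

noncomputable section

namespace Turnbull

/-- Polynomials over `R` in the symmetric indeterminates `x_{ij} = x_{ji}`, one indeterminate for
each unordered pair `s(i, j)` of indices. -/
abbrev SymPoly (n : ℕ) (R : Type*) [CommRing R] : Type _ := MvPolynomial (Sym2 (Fin n)) R

/-- The (noncommutative) ring of `R`-linear operators on polynomials; multiplication is
composition. -/
abbrev Op (n : ℕ) (R : Type*) [CommRing R] : Type _ := Module.End R (SymPoly n R)

/-- The noncommutative determinant, expanded from left to right:
`∑_σ (-1)^σ A_{σ(1)1} A_{σ(2)2} ⋯ A_{σ(n)n}`. -/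
def ncDet {n : ℕ} {A : Type*} [Ring A] (M : Fin n → Fin n → A) : A :=
  ∑ σ : Perm (Fin n), (Perm.sign σ : ℤ) • (List.ofFn fun i => M (σ i) i).prod

variable (n : ℕ) (R : Type*) [CommRing R]

/-- The operator of multiplication by a polynomial. -/
def mulOp : SymPoly n R →ₐ[R] Op n R := Algebra.lmul R (SymPoly n R)

/-- The operator `x_{ij}`: multiplication by the indeterminate `x_{ij}`. -/
def xOp (i j : Fin n) : Op n R := mulOp n R (MvPolynomial.X s(i, j))

/-- The partial derivative `∂/∂x_e` with respect to the indeterminate of the unordered pair `e`. -/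
def dOp (e : Sym2 (Fin n)) : Op n R := (MvPolynomial.pderiv e).toLinearMap

/-- The operator `(1 + δ_{jk}) ∂/∂x_{jk}`. -/
def symD (j k : Fin n) : Op n R := (1 + if j = k then 1 else 0 : R) • dOp n R s(j, k)

/-- `S_{ij} = ∑_k (1 + δ_{jk}) x_{ik} ∂/∂x_{jk}`. -/
def S (i j : Fin n) : Op n R := ∑ k, xOp n R i k * symD n R j k

theorem dOp_comm (e f : Sym2 (Fin n)) : dOp n R e * dOp n R f = dOp n R f * dOp n R e := by
  have h : ⁅(MvPolynomial.pderiv e : Derivation R (SymPoly n R) (SymPoly n R)),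
      (MvPolynomial.pderiv f : Derivation R (SymPoly n R) (SymPoly n R))⁆ = 0 := by
    refine MvPolynomial.derivation_ext fun i => ?_
    classical
    simp [Derivation.commutator_apply, MvPolynomial.pderiv_X, Pi.single_apply, apply_ite]
  refine LinearMap.ext fun p => ?_
  have h2 := DFunLike.congr_fun h p
  rw [Derivation.commutator_apply] at h2
  exact sub_eq_zero.1 h2

/-- `H ↦ H(∂/∂x)`: the algebra homomorphism that replaces each indeterminate by the corresponding
partial derivative; it is evaluation in the commutative algebra generated by these. -/
def evalD : SymPoly n R →ₐ[R] Op n R :=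
  letI : CommRing (Algebra.adjoin R (Set.range (dOp n R))) :=
    { (inferInstance : Ring (Algebra.adjoin R (Set.range (dOp n R)))) with
      mul_comm := (Algebra.isMulCommutative_adjoin R (by
        rintro _ ⟨e, rfl⟩ _ ⟨f, rfl⟩
        exact dOp_comm n R e f)).is_comm.comm }
  (Algebra.adjoin R (Set.range (dOp n R))).val.comp
    (MvPolynomial.aeval fun e => ⟨dOp n R e, Algebra.subset_adjoin ⟨e, rfl⟩⟩)

/-- Polynomials in two commuting systems of symmetric indeterminates: `x_e` (`Sum.inl e`) and
`y_e` (`Sum.inr e`). -/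
abbrev XYPoly : Type _ := MvPolynomial (Sym2 (Fin n) ⊕ Sym2 (Fin n)) R

/-- `F ↦ F(∂)`: the `R`-linear map with `(G(x) H(y))(∂) = G(x) H(∂/∂x)`, defined on the basis of
monomials in `x` and `y`. -/
def toOp : XYPoly n R →ₗ[R] Op n R :=
  (MvPolynomial.basisMonomials (Sym2 (Fin n) ⊕ Sym2 (Fin n)) R).constr R fun d =>
    mulOp n R (MvPolynomial.monomial (Finsupp.sumFinsuppEquivProdFinsupp d).1 1) *
      evalD n R (MvPolynomial.monomial (Finsupp.sumFinsuppEquivProdFinsupp d).2 1)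

/-- `Σ_{ij} = ∑_k (1 + δ_{jk}) x_{ik} y_{jk}`. -/
def Sig (i j : Fin n) : XYPoly n R :=
  ∑ k, (1 + if j = k then 1 else 0 : R) •
    (MvPolynomial.X (Sum.inl s(i, k)) * MvPolynomial.X (Sum.inr s(j, k)))

/-- Capelli configurations `(σ, φ)`: a permutation `σ`, and for each fixed point `i` of `σ` an
index `φ(i) ≤ i`. -/
abbrev Config : Type :=
  Σ σ : Perm (Fin n), ∀ i : {i : Fin n // σ i = i}, {j : Fin n // j ≤ i.1}

/-- The set `𝒞^m` of configurations such that `σ(k) = k` and `φ(k) < k` imply `k ≥ m`. Indices are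
counted from `1` in the informal notation, so that `k : Fin n` stands for the index `k + 1`. -/
def configs (m : ℕ) : Finset (Config n) :=
  Finset.univ.filter fun c =>
    ∀ k : Fin n, ∀ h : c.1 k = k, (c.2 ⟨k, h⟩ : Fin n) < k → m ≤ (k : ℕ) + 1

variable {n}

/-- The factor `Σ̃_{σ(i)i}`: it is `Σ_{σ(i)i}` if `σ(i) ≠ i` or `φ(i) = i`, and `1` otherwise. -/
def sigTilde (c : Config n) (i : Fin n) : XYPoly n R :=
  if ∀ h : c.1 i = i, (c.2 ⟨i, h⟩ : Fin n) = i then Sig n R (c.1 i) i else 1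

/-- `Σ(σ, φ, m) = Σ̃_{σ(n)n}(∂) ⋯ Σ̃_{σ(m)m}(∂) · (Σ̃_{σ(m-1),m-1} ⋯ Σ̃_{σ(1)1})(∂)`, with indices
counted from `1` (so `i : Fin n` stands for the index `i + 1`). -/
def sigOp (c : Config n) (m : ℕ) : Op n R :=
  (((List.finRange n).reverse.filter fun i : Fin n => m ≤ i.val + 1).map
      fun i => toOp n R (sigTilde R c i)).prod *
    toOp n R (∏ i : Fin n with i.val + 1 < m, sigTilde R c i)

end Turnbull

end

/-!
Normal ordering `F ↦ F(∂)` turns composition with `S_{ap}` into multiplication by `Σ_{ap}` plus the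
action of the polarization `D_{ap} = ∑_k (1 + δ_{pk}) x_{ak} ∂/∂x_{pk}`:
`S_{ap} F(∂) = (Σ_{ap} F + D_{ap} F)(∂)`. Moreover `D_{ap} Σ_{bi} = δ_{bp} Σ_{ai} + E` with
`E = (1 + δ_{ip}) x_{ab} y_{ip}` symmetric in `a` and `b`, so `D_{ap} Σ_{bi} + δ_{ap} Σ_{bi}` is
symmetric in `a` and `b`. Put `S_{σ(p)p}`, with `1` added for each later column `i` when
`σ(p) = p`, in front of the normally ordered product of the `Σ_{σ(i)i}` over these columns. Besides
the normally ordered product there is one correction for each `i`, and it is unchanged when `σ(p)`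
and `σ(i)` are exchanged, so the corrections cancel in the signed sum over `σ`.

Absorbing the columns one at a time gives `det (Σ_{ij})(∂)`, and `Σ = X Yᵀ` for the matrices
`X = (x_{ij})` and `Y = ((1 + δ_{ij}) y_{ij})`. For the statement on configurations, summing over
the values `φ(i)` at a fixed point `i ≥ m` produces exactly the shift `S_{ii} + (i - 1)`.
-/

namespace Turnbull

open Finset MvPolynomial

section Generalities

theorem derivation_prod {R A ι : Type*} [CommSemiring R] [CommSemiring A] [Algebra R A]
    [DecidableEq ι] (D : Derivation R A A) (s : Finset ι) (f : ι → A) :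
    D (∏ i ∈ s, f i) = ∑ i ∈ s, D (f i) * ∏ j ∈ s.erase i, f j := by
  induction s using Finset.induction_on with
  | empty => simp
  | insert a s ha ih =>
    rw [prod_insert ha, Derivation.leibniz, sum_insert ha, ih, erase_insert ha, smul_eq_mul,
      smul_eq_mul, mul_sum, add_comm, mul_comm (∏ i ∈ s, f i)]
    congr 1
    refine sum_congr rfl fun i hi => ?_
    have hia : a ≠ i := (ne_of_mem_of_not_mem hi ha).symm
    rw [erase_insert_of_ne hia, prod_insert (fun h => ha (mem_of_mem_erase h)), mul_left_comm]

theorem sum_sign_smul_eq_zero {ι M : Type*} [Fintype ι] [DecidableEq ι] [AddCommGroup M]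
    {p i : ι} (hpi : p ≠ i) (f : Perm ι → M) (hf : ∀ σ, f (σ * swap p i) = f σ) :
    ∑ σ : Perm ι, (Perm.sign σ : ℤ) • f σ = 0 := by
  refine sum_involution (fun σ _ => σ * swap p i) (fun σ _ => ?_) (fun σ _ _ h => ?_)
    (fun _ _ => mem_univ _) (fun σ _ => ?_)
  · simp [hf, Perm.sign_swap hpi]
  · exact hpi (swap_eq_one_iff.1 (mul_eq_left.1 h))
  · rw [mul_assoc, swap_mul_self, mul_one]

theorem filter_le_eq_cons {α : Type*} [LinearOrder α] {l : List α} (hl : l.SortedLT) {a : α}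
    (ha : a ∈ l) : l.filter (a ≤ ·) = a :: l.filter (a < ·) := by
  obtain ⟨s, t, rfl⟩ := List.append_of_mem ha
  have hpair := List.pairwise_append.1 hl.pairwise
  have hs : ∀ b ∈ s, b < a := fun b hb => hpair.2.2 b hb a List.mem_cons_self
  have ht : ∀ b ∈ t, a < b := (List.pairwise_cons.1 hpair.2.1).1
  have hs_le : s.filter (a ≤ ·) = [] := by simpa [List.filter_eq_nil_iff] using hs
  have hs_lt : s.filter (a < ·) = [] := by
    simpa [List.filter_eq_nil_iff] using fun b hb => (hs b hb).le
  have ht_le : t.filter (a ≤ ·) = t := by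
    simpa [List.filter_eq_self] using fun b hb => (ht b hb).le
  have ht_lt : t.filter (a < ·) = t := by simpa [List.filter_eq_self] using ht
  simp [hs_le, hs_lt, ht_le, ht_lt]

theorem prod_map_filter_eq_prod_map_ite {M ι : Type*} [Monoid M] (q : ι → Prop) [DecidablePred q]
    (f : ι → M) (l : List ι) :
    ((l.filter q).map f).prod = (l.map fun i => if q i then f i else 1).prod := by
  induction l with
  | nil => rfl
  | cons a l ih => by_cases h : q a <;> simp [h, ih]

theorem prod_map_sum_eq_sum_piFinset {ι κ A : Type*} [Fintype ι] [DecidableEq ι] [Semiring A]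
    {l : List ι} (hl : l.Nodup) (hmem : ∀ i, i ∈ l) (s : ι → Finset κ) (f : ι → κ → A) :
    (l.map fun i => ∑ x ∈ s i, f i x).prod =
      ∑ g ∈ Fintype.piFinset s, (l.map fun i => f i (g i)).prod := by
  let listProd : MultilinearMap ℕ (fun _ : ι => A) A :=
    (MultilinearMap.mkPiAlgebraFin ℕ l.length A).domDomCongr (hl.getEquivOfForallMemList l hmem)
  have listProd_apply (f : ι → A) : listProd f = (l.map f).prod := by
    simp only [listProd, MultilinearMap.domDomCongr_apply, MultilinearMap.mkPiAlgebraFin_apply,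
      List.Nodup.getEquivOfForallMemList_apply]
    rw [← Function.comp_def f, ← List.map_ofFn, List.ofFn_get]
  simpa only [listProd_apply] using listProd.map_sum_finset f s

theorem prod_map_filter_sum_eq_sum_piFinset {ι κ A : Type*} [Fintype ι] [DecidableEq ι]
    [Semiring A] {l : List ι} (hl : l.Nodup) (hmem : ∀ i, i ∈ l) (q : ι → Prop) [DecidablePred q]
    {s : ι → Finset κ} (hs : ∀ i, ¬ q i → #(s i) = 1) (f : ι → κ → A) :
    ((l.filter q).map fun i => ∑ x ∈ s i, f i x).prod =
      ∑ g ∈ Fintype.piFinset s, ((l.filter q).map fun i => f i (g i)).prod := by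
  have hsum (i : ι) : (if q i then ∑ x ∈ s i, f i x else 1) =
      ∑ x ∈ s i, if q i then f i x else 1 := by
    split_ifs with hi
    · rfl
    · simp [hs i hi]
  simp only [prod_map_filter_eq_prod_map_ite, hsum]
  exact prod_map_sum_eq_sum_piFinset hl hmem s fun i x => if q i then f i x else 1

end Generalities

/-- The algebra behind identities of Capelli type. A matrix `op` over a ring of operators has a
matrix of commuting symbols, and `normal` is the normal ordering of polynomials in the symbols:
`op_mul_normal` says how a product of an operator and a normally ordered one is reordered, and
`exchange` that `D_{ap} Σ_{bi} + δ_{ap} Σ_{bi}` is symmetric in `a` and `b`, where `Σ` is `symbol`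
and `D` is `polarization`. -/
structure CapelliSystem (ι R P A : Type*) [DecidableEq ι] [CommRing R] [CommRing P] [Algebra R P]
    [Ring A] where
  normal : P →+ A
  symbol : Matrix ι ι P
  op : Matrix ι ι A
  polarization : ι → ι → Derivation R P P
  normal_one : normal 1 = 1
  op_mul_normal : ∀ a p F,
    op a p * normal F = normal (symbol a p * F + polarization a p F)
  exchange : ∀ a b p i,
    polarization a p (symbol b i) + (if a = p then symbol b i else 0) =
      polarization b p (symbol a i) + (if b = p then symbol a i else 0)

namespace CapelliSystem

variable {ι R P A : Type*} [CommRing R] [CommRing P] [Algebra R P] [Ring A]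

section DecidableEq

variable [DecidableEq ι] (C : CapelliSystem ι R P A)

theorem normal_symbol (a p : ι) : C.normal (C.symbol a p) = C.op a p := by
  simpa [C.normal_one] using (C.op_mul_normal a p 1).symm

/-- The entry in row `a` and column `i` of the matrix `C.op`, with `k` added on the diagonal. -/
def shifted (k : ℕ) (a i : ι) : A := C.op a i + if a = i then (k : A) else 0

/-- The correction that arises from column `i` when the operator in column `p` is moved past the
normally ordered product of the `Σ_{σ(j)j}`, `j ∈ s`. -/
def exchangeTerm (s : Finset ι) (p i : ι) (σ : ι → ι) : P :=
  (C.polarization (σ p) p (C.symbol (σ i) i) + if σ p = p then C.symbol (σ i) i else 0) *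
    ∏ j ∈ s.erase i, C.symbol (σ j) j

theorem exchangeTerm_mul_swap {s : Finset ι} {p : ι} (hp : p ∉ s) (i : ι) (σ : Perm ι) :
    C.exchangeTerm s p i ⇑(σ * swap p i) = C.exchangeTerm s p i σ := by
  have hprod : ∏ j ∈ s.erase i, C.symbol ((σ * swap p i) j) j =
      ∏ j ∈ s.erase i, C.symbol (σ j) j := by
    refine prod_congr rfl fun j hj => ?_
    rw [Perm.mul_apply, swap_apply_of_ne_of_ne (ne_of_mem_of_not_mem (mem_of_mem_erase hj) hp)
      (ne_of_mem_erase hj)]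
  rw [exchangeTerm, exchangeTerm, hprod, Perm.mul_apply, Perm.mul_apply, swap_apply_left,
    swap_apply_right, C.exchange]

theorem shifted_mul_normal_prod {s : Finset ι} {p : ι} (hp : p ∉ s) (σ : ι → ι) :
    C.shifted #s (σ p) p * C.normal (∏ i ∈ s, C.symbol (σ i) i) =
      C.normal (∏ i ∈ insert p s, C.symbol (σ i) i) +
        ∑ i ∈ s, C.normal (C.exchangeTerm s p i σ) := by
  have hshift : (if σ p = p then (#s : A) else 0) * C.normal (∏ i ∈ s, C.symbol (σ i) i) =
      C.normal (∑ i ∈ s, (if σ p = p then C.symbol (σ i) i else 0) *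
        ∏ j ∈ s.erase i, C.symbol (σ j) j) := by
    split_ifs
    · rw [sum_congr rfl fun i hi => mul_prod_erase s (fun j => C.symbol (σ j) j) hi, sum_const,
        map_nsmul, nsmul_eq_mul]
    · simp
  rw [shifted, add_mul, C.op_mul_normal, hshift, prod_insert hp, map_add, add_assoc, ← map_add,
    derivation_prod, ← sum_add_distrib, map_sum]
  simp only [exchangeTerm, add_mul]

variable [Fintype ι]

theorem sum_sign_smul_mul_shifted_mul_normal_prod {s : Finset ι} {p : ι} (hp : p ∉ s)
    {L : (ι → ι) → A} (hL : DependsOn L (↑(insert p s))ᶜ) :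
    ∑ σ : Perm ι, (Perm.sign σ : ℤ) •
        (L σ * (C.shifted #s (σ p) p * C.normal (∏ i ∈ s, C.symbol (σ i) i))) =
      ∑ σ : Perm ι, (Perm.sign σ : ℤ) • (L σ * C.normal (∏ i ∈ insert p s, C.symbol (σ i) i)) := by
  have hcancel : ∀ i ∈ s,
      ∑ σ : Perm ι, (Perm.sign σ : ℤ) • (L σ * C.normal (C.exchangeTerm s p i σ)) = 0 := by
    refine fun i hi => sum_sign_smul_eq_zero (ne_of_mem_of_not_mem hi hp).symm _ fun σ => ?_
    have hLσ : L ⇑(σ * swap p i) = L σ := by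
      refine hL fun j hj => ?_
      have hj' : j ∉ insert p s := hj
      have hjp : j ≠ p := (ne_of_mem_of_not_mem (mem_insert_self p s) hj').symm
      have hji : j ≠ i := (ne_of_mem_of_not_mem (mem_insert_of_mem hi) hj').symm
      rw [Perm.mul_apply, swap_apply_of_ne_of_ne hjp hji]
    rw [hLσ, C.exchangeTerm_mul_swap hp]
  simp only [C.shifted_mul_normal_prod hp, mul_add, smul_add, sum_add_distrib, mul_sum, smul_sum]
  rw [add_eq_left, sum_comm]
  exact sum_eq_zero hcancel

end DecidableEq

variable [LinearOrder ι] [Fintype ι] (C : CapelliSystem ι R P A)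

theorem sum_sign_smul_mul_prod_sort (s : Finset ι) {L : (ι → ι) → A} (hL : DependsOn L (↑s)ᶜ) :
    ∑ σ : Perm ι, (Perm.sign σ : ℤ) •
        (L σ * (s.sort.map fun i => C.shifted #{j ∈ s | i < j} (σ i) i).prod) =
      ∑ σ : Perm ι, (Perm.sign σ : ℤ) • (L σ * C.normal (∏ i ∈ s, C.symbol (σ i) i)) := by
  induction s using Finset.induction_on_min generalizing L with
  | empty => simp [C.normal_one]
  | insert p s hps ih =>
    have hp : p ∉ s := fun h => (hps p h).false
    have hlater : #{j ∈ insert p s | p < j} = #s := by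
      rw [filter_insert, if_neg (lt_irrefl p), filter_true_of_mem hps]
    have hrest (σ : Perm ι) :
        (s.sort.map fun i => C.shifted #{j ∈ insert p s | i < j} (σ i) i) =
          s.sort.map fun i => C.shifted #{j ∈ s | i < j} (σ i) i := by
      refine List.map_congr_left fun i hi => ?_
      rw [filter_insert, if_neg (hps i ((mem_sort _).1 hi)).not_gt]
    have hL' : DependsOn (fun σ : ι → ι => L σ * C.shifted #s (σ p) p) (↑s)ᶜ := by
      intro σ τ h
      have hL_eq : L σ = L τ := hL fun i hi => h i fun his => hi (mem_insert_of_mem his)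
      simp only [hL_eq, h p hp]
    rw [← C.sum_sign_smul_mul_shifted_mul_normal_prod hp hL]
    simp only [sort_insert _ (fun i hi => (hps i hi).le) hp, List.map_cons, List.prod_cons, hlater,
      hrest, ← mul_assoc]
    simpa only [mul_assoc] using ih hL'

theorem sum_sign_smul_prod_sort_univ :
    ∑ σ : Perm ι, (Perm.sign σ : ℤ) •
        ((univ.sort).map fun i => C.shifted #{j | i < j} (σ i) i).prod =
      C.normal C.symbol.det := by
  have h := C.sum_sign_smul_mul_prod_sort univ (L := fun _ => 1) fun _ _ _ => rfl
  simp only [one_mul] at h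
  rw [h, Matrix.det_apply, map_sum]
  simp only [Units.smul_def, map_zsmul]

end CapelliSystem

section NormalOrdering

theorem rename_monomial_mul_rename_monomial {σ τ R : Type*} [CommSemiring R] (u : σ →₀ ℕ)
    (v : τ →₀ ℕ) (a b : R) :
    rename Sum.inl (monomial u a) * rename Sum.inr (monomial v b) =
      monomial (u.sumElim v) (a * b) := by
  rw [rename_monomial, rename_monomial, monomial_mul, Finsupp.sumElim_eq_add]

theorem induction_on_rename_mul_rename {σ τ R : Type*} [CommSemiring R]
    {motive : MvPolynomial (σ ⊕ τ) R → Prop} (F : MvPolynomial (σ ⊕ τ) R)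
    (add : ∀ F G, motive F → motive G → motive (F + G))
    (rename_mul_rename : ∀ (G : MvPolynomial σ R) (H : MvPolynomial τ R),
      motive (rename Sum.inl G * rename Sum.inr H)) : motive F := by
  refine MvPolynomial.induction_on' F (fun d a => ?_) add
  obtain ⟨⟨u, v⟩, rfl⟩ := Finsupp.sumFinsuppEquivProdFinsupp.symm.surjective d
  simpa [rename_monomial_mul_rename_monomial] using
    rename_mul_rename (monomial u a) (monomial v 1)

variable (n : ℕ) (R : Type*) [CommRing R]

theorem evalD_X (e : Sym2 (Fin n)) : evalD n R (X e) = dOp n R e := by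
  simp [evalD]

theorem toOp_monomial_sumElim (u v : Sym2 (Fin n) →₀ ℕ) :
    toOp n R (monomial (u.sumElim v) 1) =
      mulOp n R (monomial u 1) * evalD n R (monomial v 1) := by
  have h := (basisMonomials (Sym2 (Fin n) ⊕ Sym2 (Fin n)) R).constr_basis R (fun d =>
    mulOp n R (monomial (Finsupp.sumFinsuppEquivProdFinsupp d).1 1) *
      evalD n R (monomial (Finsupp.sumFinsuppEquivProdFinsupp d).2 1)) (u.sumElim v)
  simpa [toOp] using h

theorem toOp_rename_mul_rename (G H : SymPoly n R) :
    toOp n R (rename Sum.inl G * rename Sum.inr H) = mulOp n R G * evalD n R H := by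
  induction G using MvPolynomial.induction_on' with
  | add p q hp hq => simp only [map_add, add_mul, hp, hq]
  | monomial u a =>
    induction H using MvPolynomial.induction_on' with
    | add p q hp hq => simp only [map_add, mul_add, hp, hq]
    | monomial v b =>
      have hsmul {σ : Type} (d : σ →₀ ℕ) (c : R) : monomial d c = c • monomial d (1 : R) := by
        rw [smul_monomial, smul_eq_mul, mul_one]
      rw [rename_monomial_mul_rename_monomial, hsmul, hsmul u, hsmul v, map_smul, map_smul,
        map_smul, smul_mul_smul_comm, toOp_monomial_sumElim]

theorem toOp_one : toOp n R 1 = 1 := by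
  simpa using toOp_rename_mul_rename n R 1 1

theorem toOp_X_inl_mul (e : Sym2 (Fin n)) (F : XYPoly n R) :
    toOp n R (X (Sum.inl e) * F) = mulOp n R (X e) * toOp n R F := by
  induction F using induction_on_rename_mul_rename with
  | add F G hF hG => rw [mul_add, map_add, map_add, mul_add, hF, hG]
  | rename_mul_rename G H =>
    rw [← rename_X (R := R) Sum.inl e, ← mul_assoc, ← map_mul, toOp_rename_mul_rename,
      toOp_rename_mul_rename, map_mul, mul_assoc]

theorem dOp_mul_mulOp (e : Sym2 (Fin n)) (G : SymPoly n R) :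
    dOp n R e * mulOp n R G = mulOp n R G * dOp n R e + mulOp n R (pderiv e G) := by
  refine LinearMap.ext fun p => ?_
  change pderiv e (G * p) = G * pderiv e p + pderiv e G * p
  rw [Derivation.leibniz, smul_eq_mul, smul_eq_mul, mul_comm p]

theorem dOp_mul_toOp (e : Sym2 (Fin n)) (F : XYPoly n R) :
    dOp n R e * toOp n R F = toOp n R (X (Sum.inr e) * F + pderiv (Sum.inl e) F) := by
  induction F using induction_on_rename_mul_rename with
  | add F G hF hG =>
    simp only [map_add, mul_add] at hF hG ⊢
    rw [hF, hG, add_add_add_comm]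
  | rename_mul_rename G H =>
    have hy : X (Sum.inr e) * (rename Sum.inl G * rename Sum.inr H : XYPoly n R) =
        rename Sum.inl G * rename Sum.inr (X e * H) := by
      rw [map_mul, rename_X, mul_left_comm]
    have hH : pderiv (Sum.inl e) (rename Sum.inr H : XYPoly n R) = 0 := by
      classical
      refine pderiv_eq_zero_of_notMem_vars fun h => ?_
      simpa using vars_rename Sum.inr H h
    have hx : pderiv (Sum.inl e) (rename Sum.inl G * rename Sum.inr H : XYPoly n R) =
        rename Sum.inl (pderiv e G) * rename Sum.inr H := by
      rw [Derivation.leibniz, hH, smul_zero, zero_add, pderiv_rename Sum.inl_injective,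
        smul_eq_mul, mul_comm]
    rw [map_add, hy, hx, toOp_rename_mul_rename, toOp_rename_mul_rename, toOp_rename_mul_rename,
      ← mul_assoc, dOp_mul_mulOp, map_mul, evalD_X, add_mul, mul_assoc]

end NormalOrdering

section Polarization

variable (n : ℕ) (R : Type*) [CommRing R]

/-- The polarization `D_{ij} = ∑_k (1 + δ_{jk}) x_{ik} ∂/∂x_{jk}`, as a derivation of the
polynomials in `x` and `y` that treats the `y` as constants. -/
noncomputable def polarization (i j : Fin n) : Derivation R (XYPoly n R) (XYPoly n R) :=
  ∑ k, (1 + if j = k then 1 else 0 : R) •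
    ((X (Sum.inl s(i, k)) : XYPoly n R) • pderiv (Sum.inl s(j, k)))

theorem polarization_apply (i j : Fin n) (F : XYPoly n R) :
    polarization n R i j F = ∑ k, (1 + if j = k then 1 else 0 : R) •
      ((X (Sum.inl s(i, k)) : XYPoly n R) * pderiv (Sum.inl s(j, k)) F) := by
  rw [polarization, ← Derivation.coeFnAddMonoidHom_apply, map_sum, Finset.sum_apply]
  rfl

theorem S_mul_toOp (i j : Fin n) (F : XYPoly n R) :
    S n R i j * toOp n R F = toOp n R (Sig n R i j * F + polarization n R i j F) := by
  rw [S, sum_mul, polarization_apply, Sig, sum_mul, ← sum_add_distrib, map_sum]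
  refine sum_congr rfl fun k _ => ?_
  rw [symD, mul_smul_comm, smul_mul_assoc, mul_assoc, dOp_mul_toOp, xOp, ← toOp_X_inl_mul,
    smul_mul_assoc, ← smul_add, map_smul, mul_add, mul_assoc]

theorem one_add_ite_smul_pderiv_X_inl (p k b l : Fin n) :
    (1 + if p = k then 1 else 0 : R) •
        pderiv (Sum.inl s(p, k)) (X (Sum.inl s(b, l)) : XYPoly n R) =
      (if b = p ∧ l = k then 1 else 0) + if b = k ∧ l = p then 1 else 0 := by
  classical
  have hpair : s(b, l) = s(p, k) ↔ b = p ∧ l = k ∨ b = k ∧ l = p := Sym2.eq_iff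
  simp only [pderiv_X, Pi.single_apply, Sum.inl.injEq, hpair]
  by_cases hpk : p = k
  · subst hpk
    by_cases h : b = p ∧ l = p <;> simp [h, add_smul]
  · by_cases h : b = p ∧ l = k <;> simp [hpk, h]

theorem polarization_X_inl (a p b l : Fin n) :
    polarization n R a p (X (Sum.inl s(b, l))) =
      (if b = p then X (Sum.inl s(a, l)) else 0) + (if l = p then X (Sum.inl s(a, b)) else 0) := by
  simp only [polarization_apply, ← mul_smul_comm, one_add_ite_smul_pderiv_X_inl, mul_add,
    sum_add_distrib, mul_ite, mul_one, mul_zero, and_comm (a := b = p), ite_and, sum_ite_eq,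
    mem_univ, if_true]

theorem polarization_X_inr (a p : Fin n) (e : Sym2 (Fin n)) :
    polarization n R a p (X (Sum.inr e)) = 0 := by
  classical
  simp [polarization_apply, pderiv_X]

theorem polarization_Sig (a p b i : Fin n) :
    polarization n R a p (Sig n R b i) = (if b = p then Sig n R a i else 0) +
      (1 + if i = p then 1 else 0 : R) • (X (Sum.inl s(a, b)) * X (Sum.inr s(i, p))) := by
  simp only [Sig, map_sum, Derivation.map_smul, Derivation.leibniz, polarization_X_inl,
    polarization_X_inr, smul_eq_mul, mul_zero, zero_add, mul_add, smul_add, sum_add_distrib]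
  congr 1
  · split_ifs <;> simp [mul_comm]
  · simp [mul_comm]

/-- The Capelli system of Turnbull's identity: the operators `S_{ij}` with their symbols `Σ_{ij}`,
ordered by `F ↦ F(∂)`. -/
noncomputable def turnbullSystem : CapelliSystem (Fin n) R (XYPoly n R) (Op n R) where
  normal := (toOp n R).toAddMonoidHom
  symbol := Sig n R
  op := S n R
  polarization := polarization n R
  normal_one := toOp_one n R
  op_mul_normal := S_mul_toOp n R
  exchange a b p i := by
    rw [polarization_Sig, polarization_Sig, Sym2.eq_swap (a := a), add_right_comm,
      add_right_comm (if a = p then _ else _), add_comm (if b = p then _ else _)]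

end Polarization

section Configurations

variable {n : ℕ}

/-- The function `φ` of a configuration, extended to all indices by `φ(i) = i` off the fixed
points of `σ`. -/
def extendedChoice (c : Config n) (i : Fin n) : Fin n :=
  if h : c.1 i = i then c.2 ⟨i, h⟩ else i

/-- The values at `i` of the extended functions `φ` of the configurations `(σ, φ)` in `𝒞^m`. -/
def choices (σ : Perm (Fin n)) (m : ℕ) (i : Fin n) : Finset (Fin n) :=
  if σ i = i ∧ m ≤ (i : ℕ) + 1 then Iic i else {i}

theorem mem_configs_iff_extendedChoice_mem {m : ℕ} {c : Config n} :
    c ∈ configs n m ↔ ∀ i, extendedChoice c i ∈ choices c.1 m i := by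
  simp only [configs, mem_filter, mem_univ, true_and]
  refine forall_congr' fun i => ?_
  by_cases hσ : c.1 i = i
  · have hle : (c.2 ⟨i, hσ⟩ : Fin n) ≤ i := (c.2 ⟨i, hσ⟩).2
    by_cases hi : m ≤ (i : ℕ) + 1
    · simp [extendedChoice, choices, hσ, hi, hle]
    · simp [extendedChoice, choices, hσ, hi, hle.ge_iff_eq]
  · simp [extendedChoice, choices, hσ]

theorem sum_configs_eq_sum_piFinset_choices {M : Type*} [AddCommMonoid M] (m : ℕ)
    (f : Perm (Fin n) → (Fin n → Fin n) → M) :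
    ∑ c ∈ configs n m, f c.1 (extendedChoice c) =
      ∑ σ, ∑ ψ ∈ Fintype.piFinset (choices σ m), f σ ψ := by
  have hle {σ : Perm (Fin n)} {i j : Fin n} (h : j ∈ choices σ m i) : j ≤ i := by
    rw [choices] at h
    split_ifs at h
    · exact mem_Iic.1 h
    · exact (mem_singleton.1 h).le
  have hchoice {σ : Perm (Fin n)} {ψ : Fin n → Fin n} (hψ : ∀ i, ψ i ∈ choices σ m i) :
      extendedChoice ⟨σ, fun i => ⟨ψ i, hle (hψ i)⟩⟩ = ψ := by
    funext i
    by_cases hσ : σ i = i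
    · simp [extendedChoice, hσ]
    · simpa [extendedChoice, choices, hσ, eq_comm] using hψ i
  rw [sum_sigma']
  refine sum_bij' (fun c _ => ⟨c.1, extendedChoice c⟩)
    (fun x hx => ⟨x.1, fun i => ⟨x.2 i, hle (Fintype.mem_piFinset.1 (mem_sigma.1 hx).2 i)⟩⟩)
    (fun c hc => ?_) (fun x hx => ?_) (fun c _ => ?_) (fun x hx => ?_) (fun _ _ => rfl)
  · simpa using mem_configs_iff_extendedChoice_mem.1 hc
  · have hψ := Fintype.mem_piFinset.1 (mem_sigma.1 hx).2
    exact mem_configs_iff_extendedChoice_mem.2 fun i => by rw [hchoice hψ]; exact hψ i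
  · refine Sigma.ext rfl (heq_of_eq (funext fun i => Subtype.ext ?_))
    exact dif_pos i.2
  · exact Sigma.ext rfl (heq_of_eq (hchoice (Fintype.mem_piFinset.1 (mem_sigma.1 hx).2)))

variable (R : Type*) [CommRing R]

theorem sigTilde_eq_ite (c : Config n) (i : Fin n) :
    sigTilde R c i = if extendedChoice c i = i then Sig n R (c.1 i) i else 1 := by
  refine if_congr ?_ rfl rfl
  by_cases h : c.1 i = i <;> simp [extendedChoice, h]

theorem sum_choices_eq_shifted (σ : Perm (Fin n)) {m : ℕ} {i : Fin n} (hi : m ≤ (i : ℕ) + 1) :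
    ∑ j ∈ choices σ m i, (if j = i then S n R (σ i) i else 1) =
      (turnbullSystem n R).shifted i (σ i) i := by
  by_cases hσ : σ i = i
  · have hchoices : choices σ m i = insert i (Iio i) := by
      rw [choices, if_pos ⟨hσ, hi⟩, Iio_insert]
    have hlt : ∑ j ∈ Iio i, (if j = i then S n R (σ i) i else 1) = ((i : ℕ) : Op n R) := by
      rw [sum_congr rfl fun j hj => if_neg (mem_Iio.1 hj).ne, sum_const, Fin.card_Iio, nsmul_one]
    rw [hchoices, sum_insert (by simp), if_pos rfl, hlt, CapelliSystem.shifted, if_pos hσ]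
    rfl
  · rw [choices, if_neg fun h => hσ h.1, sum_singleton, if_pos rfl, CapelliSystem.shifted,
      if_neg hσ, add_zero]
    rfl

/-- The sum of the `Σ(σ, φ, m)` over the configurations `(σ, φ)` in `𝒞^m` with a given `σ`: the
operators of the columns `i ≥ m`, shifted by `i - 1` on the diagonal, in front of the normally
ordered product of the columns `i < m`. -/
noncomputable def columnOp (m : ℕ) (σ : Fin n → Fin n) : Op n R :=
  (((List.finRange n).reverse.filter fun i : Fin n => m ≤ i.val + 1).map fun i : Fin n =>
      (turnbullSystem n R).shifted i (σ i) i).prod *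
    toOp n R (∏ i : Fin n with i.val + 1 < m, Sig n R (σ i) i)

theorem sigOp_eq_of_mem_configs {m : ℕ} {c : Config n} (hc : c ∈ configs n m) :
    sigOp R c m =
      (((List.finRange n).reverse.filter fun i : Fin n => m ≤ i.val + 1).map fun i =>
          if extendedChoice c i = i then S n R (c.1 i) i else 1).prod *
        toOp n R (∏ i : Fin n with i.val + 1 < m, Sig n R (c.1 i) i) := by
  have hfixed (i : Fin n) (hi : i.val + 1 < m) : extendedChoice c i = i := by
    have h := mem_configs_iff_extendedChoice_mem.1 hc i
    rwa [choices, if_neg fun h => hi.not_ge h.2, mem_singleton] at h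
  have hprod : ∏ i : Fin n with i.val + 1 < m, sigTilde R c i =
      ∏ i : Fin n with i.val + 1 < m, Sig n R (c.1 i) i :=
    prod_congr rfl fun i hi => by rw [sigTilde_eq_ite, if_pos (hfixed i (mem_filter.1 hi).2)]
  have htoOp (i : Fin n) : toOp n R (sigTilde R c i) =
      if extendedChoice c i = i then S n R (c.1 i) i else 1 := by
    rw [sigTilde_eq_ite, apply_ite (toOp n R), toOp_one]
    exact if_congr Iff.rfl ((turnbullSystem n R).normal_symbol _ _) rfl
  simp only [sigOp, hprod, htoOp]

theorem sum_configs_sign_smul_sigOp (m : ℕ) :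
    ∑ c ∈ configs n m, (Perm.sign c.1 : ℤ) • sigOp R c m =
      ∑ σ : Perm (Fin n), (Perm.sign σ : ℤ) • columnOp R m σ := by
  rw [sum_congr rfl fun c hc => by rw [sigOp_eq_of_mem_configs R hc],
    sum_configs_eq_sum_piFinset_choices m fun σ ψ => (Perm.sign σ : ℤ) •
      ((((List.finRange n).reverse.filter fun i : Fin n => m ≤ i.val + 1).map fun i =>
          if ψ i = i then S n R (σ i) i else 1).prod *
        toOp n R (∏ i : Fin n with i.val + 1 < m, Sig n R (σ i) i))]
  refine sum_congr rfl fun σ _ => ?_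
  have hnodup : (List.finRange n).reverse.Nodup := List.nodup_reverse.2 (List.nodup_finRange n)
  have hcard (i : Fin n) (hi : ¬ m ≤ i.val + 1) : #(choices σ m i) = 1 := by
    rw [choices, if_neg fun h => hi h.2, card_singleton]
  rw [← smul_sum, ← sum_mul, ← prod_map_filter_sum_eq_sum_piFinset hnodup (by simp) _ hcard
    fun i j => if j = i then S n R (σ i) i else 1, columnOp]
  congr 3
  refine List.map_congr_left fun i hi => ?_
  exact sum_choices_eq_shifted R σ (by simpa using (List.mem_filter.1 hi).2)

theorem filter_reverse_finRange (p : Fin n) :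
    ((List.finRange n).reverse.filter fun i : Fin n => (p : ℕ) + 1 ≤ i.val + 1) =
      ((List.finRange n).reverse.filter fun i : Fin n => (p : ℕ) + 1 + 1 ≤ i.val + 1) ++ [p] := by
  have h := congrArg List.reverse
    (filter_le_eq_cons (List.sortedLT_finRange n) (List.mem_finRange p))
  simpa [List.filter_reverse] using h

theorem sum_sign_smul_columnOp_succ (p : Fin n) :
    ∑ σ : Perm (Fin n), (Perm.sign σ : ℤ) • columnOp R (p + 1) σ =
      ∑ σ : Perm (Fin n), (Perm.sign σ : ℤ) • columnOp R (p + 1 + 1) σ := by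
  have hlt : ({i | i.val + 1 < (p : ℕ) + 1} : Finset (Fin n)) = Iio p := by
    ext i
    simp
  have hle : ({i | i.val + 1 < (p : ℕ) + 1 + 1} : Finset (Fin n)) = insert p (Iio p) := by
    ext i
    simp [Iio_insert]
  have hL : DependsOn (fun σ : Fin n → Fin n =>
      (((List.finRange n).reverse.filter fun i : Fin n => (p : ℕ) + 1 + 1 ≤ i.val + 1).map
        fun i : Fin n => (turnbullSystem n R).shifted i (σ i) i).prod) (↑(insert p (Iio p)))ᶜ := by
    refine fun σ τ h => congrArg List.prod (List.map_congr_left fun i hi => ?_)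
    have hpi : p < i := by simpa using (List.mem_filter.1 hi).2
    rw [h i (by simpa [Iio_insert] using hpi)]
  have h := (turnbullSystem n R).sum_sign_smul_mul_shifted_mul_normal_prod (by simp) hL
  simp only [columnOp, hlt, hle, filter_reverse_finRange, List.map_append, List.prod_append,
    List.map_singleton, List.prod_singleton, mul_assoc]
  simp only [Fin.card_Iio] at h
  exact h

theorem columnOp_one (σ : Fin n → Fin n) : columnOp R 1 σ = columnOp R 0 σ := by
  simp [columnOp]

end Configurations

section Determinants

theorem ncDet_map {n : ℕ} {P A : Type*} [CommRing P] [Ring A] (f : P →+* A)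
    (M : Matrix (Fin n) (Fin n) P) : ncDet (fun i j => f (M i j)) = f M.det := by
  rw [ncDet, Matrix.det_apply, map_sum]
  refine sum_congr rfl fun σ _ => ?_
  rw [Units.smul_def, map_zsmul, ← List.prod_ofFn, map_list_prod, List.map_ofFn]
  rfl

variable (n : ℕ) (R : Type*) [CommRing R]

/-- The matrix `(x_{ij})`. -/
noncomputable def xMatrix : Matrix (Fin n) (Fin n) (SymPoly n R) := Matrix.of fun i j => X s(i, j)

/-- The matrix `((1 + δ_{ij}) x_{ij})`, the symbol of `((1 + δ_{ij}) ∂/∂x_{ij})`. -/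
noncomputable def dMatrix : Matrix (Fin n) (Fin n) (SymPoly n R) :=
  Matrix.of fun i j => (1 + if i = j then 1 else 0 : R) • X s(i, j)

theorem ncDet_xOp : ncDet (xOp n R) = mulOp n R (xMatrix n R).det :=
  ncDet_map (mulOp n R).toRingHom (xMatrix n R)

theorem ncDet_symD : ncDet (symD n R) = evalD n R (dMatrix n R).det := by
  have h : symD n R = fun i j => evalD n R (dMatrix n R i j) := by
    funext i j
    rw [dMatrix, Matrix.of_apply, map_smul, evalD_X, symD]
  rw [h]
  exact ncDet_map (evalD n R).toRingHom (dMatrix n R)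

theorem Sig_eq_mul_transpose :
    Matrix.of (Sig n R) = (xMatrix n R).map (rename Sum.inl) *
      ((dMatrix n R).map (rename Sum.inr)).transpose := by
  ext1 i j
  simp [Matrix.mul_apply, xMatrix, dMatrix, Sig]

theorem toOp_det_Sig :
    toOp n R (Matrix.of (Sig n R)).det = ncDet (xOp n R) * ncDet (symD n R) := by
  have hx := (rename Sum.inl : SymPoly n R →ₐ[R] XYPoly n R).map_det (xMatrix n R)
  have hd := (rename Sum.inr : SymPoly n R →ₐ[R] XYPoly n R).map_det (dMatrix n R)
  rw [AlgHom.mapMatrix_apply] at hx hd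
  rw [Sig_eq_mul_transpose, Matrix.det_mul, Matrix.det_transpose, ← hx, ← hd,
    toOp_rename_mul_rename, ncDet_xOp, ncDet_symD]

theorem ncDet_S_add_eq_toOp_det_Sig :
    ncDet (fun i j => S n R i j + if i = j then (n : Op n R) - ((i : ℕ) + 1) else 0) =
      toOp n R (Matrix.of (Sig n R)).det := by
  have hentry (σ : Perm (Fin n)) (i : Fin n) :
      S n R (σ i) i + (if σ i = i then (n : Op n R) - ((σ i : ℕ) + 1) else 0) =
        (turnbullSystem n R).shifted #{j | i < j} (σ i) i := by
    rw [CapelliSystem.shifted, filter_lt_eq_Ioi, Fin.card_Ioi, Nat.sub_sub, add_comm 1,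
      Nat.cast_sub i.isLt]
    push_cast
    congr 1
    split_ifs with h
    · rw [h]
    · rfl
  have h := (turnbullSystem n R).sum_sign_smul_prod_sort_univ
  simp only [Fin.sort_univ, ← List.ofFn_eq_map] at h
  simp only [ncDet, hentry]
  exact h

end Determinants

end Turnbull

/-- Turnbull's identity for operators on polynomials in symmetric indeterminates, and the summed
one-step identity over Capelli configurations. Here `i : Fin n` stands for the index `i + 1`
counted from `1`, so the diagonal correction `n - i` reads `n - (i + 1)`. -/
theorem mainTheorem4 (n : ℕ) (R : Type*) [CommRing R] :
    Turnbull.ncDet (fun i j => Turnbull.S n R i j +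
        (if i = j then (n : Turnbull.Op n R) - ((i : ℕ) + 1) else 0)) =
      Turnbull.ncDet (Turnbull.xOp n R) * Turnbull.ncDet (Turnbull.symD n R) ∧
    ∀ m : ℕ, m ≤ n →
      ∑ c ∈ Turnbull.configs n (m + 1),
          (Equiv.Perm.sign c.1 : ℤ) • Turnbull.sigOp R c (m + 1) =
        ∑ c ∈ Turnbull.configs n m,
          (Equiv.Perm.sign c.1 : ℤ) • Turnbull.sigOp R c m := by
  refine ⟨?_, fun m hm => ?_⟩
  · rw [Turnbull.ncDet_S_add_eq_toOp_det_Sig, Turnbull.toOp_det_Sig]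
  · rw [Turnbull.sum_configs_sign_smul_sigOp, Turnbull.sum_configs_sign_smul_sigOp]
    cases m with
    | zero => simp only [zero_add, Turnbull.columnOp_one]
    | succ k => exact (Turnbull.sum_sign_smul_columnOp_succ R ⟨k, hm⟩).symm
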